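/- A metric space is called *ultrahomogeneous* if every isometry between two of its finite subsets extends to an isometry of the whole space onto itself. The *rational Urysohn space* is the (unique up to isometry) countable ultrahomogeneous metric space with all distances rational that contains an isometric copy of every finite metric space with rational distances. The *Urysohn universal space* is the (unique up to isometry) complete separable ultrahomogeneous metric space that contains an isometric copy of every finite metric space. Theorem. Let $G$ be the free group on countably infinitely many generators. There is a metric $d$ on $G$ that is two-sided invariant, i.e. $d(gx,gy)=d(x,y)=d(xg,yg)$ for all $g,x,y\in G$, and such that $(G,d)$ is isometric to the rational Urysohn space (in particular $d$ takes only rational values). Moreover, the metric completion $\mathbb{G}$ of $(G,d)$ carries a group structure extending that of $G$ under which $\mathbb{G}$ is a non-abelian Polish topological group, the metric of $\mathbb{G}$ is two-sided invariant, and $\mathbb{G}$ is isometric to the Urysohn universal space. -/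

import Mathlib

/-- All distances of `X` are rational numbers. -/
def HasRationalDist (X : Type*) [MetricSpace X] : Prop :=
  ∀ x y : X, ∃ q : ℚ, dist x y = (q : ℝ)

/-- Every partial isometry between two finite subsets extends to an isometry of `X` onto itself. -/
def IsUltrahomogeneous (X : Type*) [MetricSpace X] : Prop :=
  ∀ (A : Set X) (f : A → X), A.Finite → Isometry f → ∃ φ : X ≃ᵢ X, ∀ a : A, φ a = f a

/-- `X` is (isometric to) the rational Urysohn space. Finite metric spaces may be taken in `Type`,
since every finite metric space is isometric to one carried by some `Fin n`. -/
structure IsRationalUrysohn (X : Type*) [MetricSpace X] : Prop where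
  countable : Countable X
  rational : HasRationalDist X
  universal : ∀ (F : Type) [Finite F] [MetricSpace F], HasRationalDist F →
    ∃ i : F → X, Isometry i
  ultrahomogeneous : IsUltrahomogeneous X

/-- `X` is (isometric to) the Urysohn universal metric space. -/
structure IsUrysohn (X : Type*) [MetricSpace X] : Prop where
  complete : CompleteSpace X
  separable : TopologicalSpace.SeparableSpace X
  universal : ∀ (F : Type) [Finite F] [MetricSpace F], ∃ i : F → X, Isometry i
  ultrahomogeneous : IsUltrahomogeneous X

/-- The metric of the group `G` is two-sided invariant. -/
structure IsTwoSidedInvariant (G : Type*) [Group G] [MetricSpace G] : Prop where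
  left : ∀ g x y : G, dist (g * x) (g * y) = dist x y
  right : ∀ g x y : G, dist (x * g) (y * g) = dist x y

/-! A two-sided invariant metric on a group amounts to a conjugation-invariant norm. By back and
forth, a countable space with rational distances is the rational Urysohn space once every admissible
(Katětov) rational function on finitely many points is the distance function of some point. So a
norm on the free group is needed that realizes all such functions, and the free generators serve as
the witnesses.

The one-point extension is of Graev type. Given an integral norm and admissible distances `f a` from
a generator `x` to words `a` without `x`, the new norm of a word is the least cost of collapsing it:
`x` may be replaced by `a` at cost `f a`, and a factor `s u s⁻¹` may be deleted at the price of
deleting `u`. `Collapse.cancel` shows that free cancellation never raises the cost, so the costs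
form an invariant norm; `IsInvNorm.exists_extension` shows that words without `x` keep their norm
and that `f` is realized. `exists_generic_norm` clears denominators and passes to the limit over
stages, one generator per stage.

For the completion, `ExtensionProperty.of_dense_rational` upgrades the rational extension property
to the real one by successive approximation. Back and forth along a dense sequence, followed by a
closure, then gives ultrahomogeneity. Invariance makes the group operations uniformly continuous, so
they extend. -/

/-- A conjugation-invariant norm on a group. -/
structure IsInvNorm {G R : Type*} [Group G] [Zero R] [Add R] [LE R] (L : G → R) : Prop where
  map_one : L 1 = 0
  eq_one : ∀ g, L g = 0 → g = 1
  map_inv : ∀ g, L g⁻¹ = L g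
  map_mul : ∀ g h, L (g * h) ≤ L g + L h
  map_conj : ∀ c g, L (c * g * c⁻¹) = L g

namespace IsInvNorm

variable {G R : Type*} [Group G] [Zero R] [Add R] [LE R] {L : G → R}

theorem map_conj' (hL : IsInvNorm L) (c g : G) : L (c⁻¹ * g * c) = L g := by
  simpa using hL.map_conj c⁻¹ g

theorem map_mul_comm (hL : IsInvNorm L) (g h : G) : L (g * h) = L (h * g) := by
  rw [← hL.map_conj h (g * h)]
  congr 1
  group

end IsInvNorm

/-! ### Collapsing words at a cost, and free cancellation -/

/-- The inverse of a letter. -/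
def invLetter {α : Type*} (s : α × Bool) : α × Bool := (s.1, !s.2)

@[simp] theorem invLetter_invLetter {α : Type*} (s : α × Bool) :
    invLetter (invLetter s) = s := by simp [invLetter]

/-- `C s g r` means that the letter `s` may be replaced by the group element `g` at cost `r`. -/
structure IsReplacement {α G : Type*} [Group G] (L : G → ℕ) (C : α × Bool → G → ℕ → Prop) :
    Prop where
  total : ∀ s, ∃ g r, C s g r
  inv : ∀ s g r, C s g r → C (invLetter s) g⁻¹ r
  cancel : ∀ s g h r t, C s g r → C (invLetter s) h t → L (g * h) ≤ r + t

/-- `Collapse L C w g r` means that the word `w` can be turned into the group element `g` at total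
cost `r`, by replacing letters and by deleting factors `s u s⁻¹`, where the deletion costs the norm
of the element into which `u` has been turned. -/
inductive Collapse {α G : Type*} [Group G] (L : G → ℕ) (C : α × Bool → G → ℕ → Prop) :
    List (α × Bool) → G → ℕ → Prop
  | nil : Collapse L C [] 1 0
  | cons {s w g h r t} : C s g r → Collapse L C w h t → Collapse L C (s :: w) (g * h) (r + t)
  | pair {s u w k h t t'} : Collapse L C u k t → Collapse L C w h t' →
      Collapse L C (s :: (u ++ invLetter s :: w)) h (t + L k + t')

namespace Collapse

variable {α G : Type*} [Group G] {L : G → ℕ} {C : α × Bool → G → ℕ → Prop}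

theorem append {u v : List (α × Bool)} {g h : G} {r t : ℕ} (hu : Collapse L C u g r)
    (hv : Collapse L C v h t) : Collapse L C (u ++ v) (g * h) (r + t) := by
  induction hu with
  | nil => simpa using hv
  | cons hc _ ih => simpa [mul_assoc, add_assoc] using Collapse.cons hc ih
  | pair h1 _ _ ih2 => simpa [mul_assoc, add_assoc] using Collapse.pair h1 ih2

theorem exists_of_total (hC : IsReplacement L C) (w : List (α × Bool)) :
    ∃ g r, Collapse L C w g r := by
  induction w with
  | nil => exact ⟨_, _, .nil⟩
  | cons s w ih =>
    obtain ⟨g, r, h⟩ := ih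
    obtain ⟨g', r', h'⟩ := hC.total s
    exact ⟨_, _, .cons h' h⟩

theorem invRev_cons' (s : α × Bool) (w : List (α × Bool)) :
    FreeGroup.invRev (s :: w) = FreeGroup.invRev w ++ [invLetter s] := by
  simp [FreeGroup.invRev, invLetter]

theorem invRev (hL : IsInvNorm L) (hC : IsReplacement L C) {w : List (α × Bool)} {g : G} {r : ℕ}
    (h : Collapse L C w g r) : Collapse L C (FreeGroup.invRev w) g⁻¹ r := by
  induction h with
  | nil => simpa [FreeGroup.invRev] using Collapse.nil
  | @cons s w g h r t hc _ ih =>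
    rw [invRev_cons', mul_inv_rev, add_comm]
    refine ih.append ?_
    simpa using Collapse.cons (hC.inv _ _ _ hc) Collapse.nil
  | @pair s u w k h t t' _ _ ih1 ih2 =>
    rw [invRev_cons', FreeGroup.invRev_append, invRev_cons', invLetter_invLetter, add_comm]
    have := ih2.append (Collapse.pair (s := s) ih1 .nil)
    simpa [hL.map_inv] using this

theorem cons_inversion {s : α × Bool} {w : List (α × Bool)} {k : G} {t : ℕ}
    (h : Collapse L C (s :: w) k t) :
    (∃ g r k' t', C s g r ∧ Collapse L C w k' t' ∧ k = g * k' ∧ t = r + t') ∨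
    ∃ u v k₁ t₁ t₂, w = u ++ invLetter s :: v ∧ Collapse L C u k₁ t₁ ∧ Collapse L C v k t₂ ∧
      t = t₁ + L k₁ + t₂ := by
  cases h with
  | cons hc hw => exact .inl ⟨_, _, _, _, hc, hw, rfl, rfl⟩
  | pair h1 h2 => exact .inr ⟨_, _, _, _, _, rfl, h1, h2, rfl⟩

/-- `Collapse` reads words from the left, so the fate of the last letter requires an induction. It
matters when the last letter of a deleted block cancels against the closing letter of that block. -/
theorem concat_inversion {w : List (α × Bool)} {k : G} {t : ℕ}
    (h : Collapse L C w k t) : ∀ {s : α × Bool} {u : List (α × Bool)}, w = u ++ [s] →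
    (∃ g r k' t', C s g r ∧ Collapse L C u k' t' ∧ k = k' * g ∧ t = t' + r) ∨
    ∃ u' v k₁ t₁ t₂, u = u' ++ invLetter s :: v ∧ Collapse L C u' k t₁ ∧ Collapse L C v k₁ t₂ ∧
      t = t₁ + t₂ + L k₁ := by
  induction h with
  | nil => intro s u h; simp at h
  | @cons s₀ w g h r t hc hw ih =>
    intro s u he
    rcases u with _ | ⟨s₁, u⟩
    · simp only [List.nil_append, List.cons.injEq] at he
      obtain ⟨rfl, rfl⟩ := he
      cases hw
      exact .inl ⟨g, r, 1, 0, hc, .nil, by simp, by simp⟩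
    · simp only [List.cons_append, List.cons.injEq] at he
      obtain ⟨rfl, he⟩ := he
      rcases ih he with ⟨g', r', k', t', h1, h2, rfl, rfl⟩ | ⟨u', v, k₁, t₁, t₂, rfl, h1, h2, rfl⟩
      · exact .inl ⟨g', r', g * k', r + t', h1, .cons hc h2, by group, by omega⟩
      · exact .inr ⟨s₀ :: u', v, k₁, r + t₁, t₂, by simp, .cons hc h1, h2, by omega⟩
  | @pair s₀ u₁ w k h t t' h1 h2 ih1 ih2 =>
    intro s u he
    rcases u with _ | ⟨s₁, u⟩
    · simp at he
    · simp only [List.cons_append, List.cons.injEq] at he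
      obtain ⟨rfl, he⟩ := he
      rcases List.eq_nil_or_concat w with rfl | ⟨w', b, rfl⟩
      · cases h2
        have := List.append_inj' he rfl
        simp only [List.cons.injEq, and_true] at this
        obtain ⟨rfl, rfl⟩ := this
        exact .inr ⟨[], u₁, k, 0, t, by simp, .nil, h1, by omega⟩
      · have he' : (u₁ ++ invLetter s₀ :: w') ++ [b] = u ++ [s] := by simpa using he
        have := List.append_inj' he' rfl
        simp only [List.cons.injEq, and_true] at this
        obtain ⟨rfl, rfl⟩ := this
        rcases ih2 (s := b) (u := w') (by simp) with
          ⟨g', r', k', t', h3, h4, rfl, rfl⟩ | ⟨u', v, k₁, t₁, t₂, rfl, h3, h4, rfl⟩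
        · exact .inl ⟨g', r', k', _, h3, .pair h1 h4, rfl, by omega⟩
        · exact .inr ⟨s₀ :: (u₁ ++ invLetter s₀ :: u'), v, k₁, _, t₂, by simp, .pair h1 h3, h4,
            by omega⟩

/-- Cancelling a letter against its inverse does not increase the cost. -/
theorem cancel (hL : IsInvNorm L) (hC : IsReplacement L C) {w : List (α × Bool)} {g : G} {r : ℕ}
    (h : Collapse L C w g r) : ∀ {s : α × Bool} {u v : List (α × Bool)},
    w = u ++ s :: invLetter s :: v →
    ∃ g' r', Collapse L C (u ++ v) g' r' ∧ r' + L (g'⁻¹ * g) ≤ r := by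
  -- The target may move from `g` to `g'`, provided the move is paid out of the cost saved. This
  -- slack lets an enclosing deletion, whose price is a norm, absorb the change.
  induction h with
  | nil => intro s u v h; simp at h
  | @cons s₀ w g h r t hc hw ih =>
    intro s u v he
    rcases u with _ | ⟨s₁, u⟩
    · simp only [List.nil_append, List.cons.injEq] at he
      obtain ⟨rfl, rfl⟩ := he
      rcases hw.cons_inversion with
        ⟨g', r', k', t', h1, h2, rfl, rfl⟩ | ⟨u', v, k₁, t₁, t₂, rfl, h1, h2, rfl⟩
      · refine ⟨k', t', h2, ?_⟩
        have e : k'⁻¹ * (g * (g' * k')) = k'⁻¹ * (g * g') * k' := by group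
        have := hC.cancel _ _ _ _ _ hc h1
        rw [e, hL.map_conj']
        omega
      -- The copy of `s₀` that loses its partner takes over the replacement of the cancelled copy.
      · rw [invLetter_invLetter]
        refine ⟨_, _, h1.append (.cons hc h2), ?_⟩
        have e : (k₁ * (g * h))⁻¹ * (g * h) = (g * h)⁻¹ * k₁⁻¹ * (g * h) := by group
        rw [e, hL.map_conj', hL.map_inv]
        omega
    · simp only [List.cons_append, List.cons.injEq] at he
      obtain ⟨rfl, he⟩ := he
      obtain ⟨g', r', h1, h2⟩ := ih he
      refine ⟨_, _, .cons hc h1, ?_⟩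
      have e : (g * g')⁻¹ * (g * h) = g'⁻¹ * h := by group
      rw [e]
      omega
  | @pair s₀ u₁ w k h t t' hu hw ih1 ih2 =>
    intro s u v he
    rcases u with _ | ⟨s₁, u⟩
    · simp only [List.nil_append, List.cons.injEq] at he
      obtain ⟨rfl, he⟩ := he
      rcases u₁ with _ | ⟨s₂, u₁⟩
      · simp only [List.nil_append, List.cons.injEq, true_and] at he
        subst he
        refine ⟨_, _, hw, ?_⟩
        simp [hL.map_one]
      · simp only [List.cons_append, List.cons.injEq] at he
        obtain ⟨rfl, rfl⟩ := he
        rcases hu.cons_inversion with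
          ⟨g', r', k', t', h1, h2, rfl, rfl⟩ | ⟨u', v, k₁, t₁, t₂, rfl, h1, h2, rfl⟩
        · refine ⟨_, _, h2.append (.cons h1 hw), ?_⟩
          have e : (k' * (g' * h))⁻¹ * h = h⁻¹ * (k' * g')⁻¹ * h := by group
          rw [e, hL.map_conj', hL.map_inv, hL.map_mul_comm]
          omega
        · rw [invLetter_invLetter, List.nil_append, List.append_assoc]
          refine ⟨_, _, h1.append (.pair h2 hw), ?_⟩
          have e : (k₁ * h)⁻¹ * h = h⁻¹ * k₁⁻¹ * h := by group
          rw [e, hL.map_conj', hL.map_inv]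
          omega
    · simp only [List.cons_append, List.cons.injEq] at he
      obtain ⟨rfl, he⟩ := he
      rcases List.append_eq_append_iff.1 he with ⟨l, rfl, hl⟩ | ⟨l, rfl, hl⟩
      · rcases l with _ | ⟨b, l⟩
        · simp only [List.nil_append, List.cons.injEq] at hl
          obtain ⟨rfl, rfl⟩ := hl
          rw [invLetter_invLetter] at hw
          rcases hw.cons_inversion with
            ⟨g', r', k', t', h1, h2, rfl, rfl⟩ | ⟨u', v, k₁, t₁, t₂, rfl, h1, h2, rfl⟩
          · refine ⟨_, _, .cons h1 ((hu.append .nil).append h2), ?_⟩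
            have e : (g' * (k * 1 * k'))⁻¹ * (g' * k') = k'⁻¹ * k⁻¹ * k' := by group
            rw [e, hL.map_conj', hL.map_inv]
            omega
          -- Two adjacent deletions `s₀ u s₀⁻¹` and `s₀ u' s₀⁻¹` merge into one, with price bounded
          -- by subadditivity of `L`.
          · refine ⟨h, t + t₁ + L (k * k₁) + t₂, ?_, ?_⟩
            · simpa using Collapse.pair (s := s₀) (hu.append h1) h2
            · have := hL.map_mul k k₁
              rw [inv_mul_cancel, hL.map_one]
              omega
        · simp only [List.cons_append, List.cons.injEq] at hl
          obtain ⟨rfl, hl⟩ := hl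
          obtain ⟨g', r', h1, h2⟩ := ih2 hl
          refine ⟨g', _, by simpa using Collapse.pair (s := s₀) hu h1, ?_⟩
          omega
      · rcases l with _ | ⟨b, l⟩
        · simp only [List.nil_append, List.cons.injEq] at hl
          obtain ⟨rfl, rfl⟩ := hl
          rw [invLetter_invLetter] at hw
          rw [List.append_nil] at hu
          rcases hw.cons_inversion with
            ⟨g', r', k', t', h1, h2, rfl, rfl⟩ | ⟨u', v, k₁, t₁, t₂, rfl, h1, h2, rfl⟩
          · refine ⟨_, _, .cons h1 (hu.append h2), ?_⟩
            have e : (g' * (k * k'))⁻¹ * (g' * k') = k'⁻¹ * k⁻¹ * k' := by group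
            rw [e, hL.map_conj', hL.map_inv]
            omega
          · refine ⟨h, t + t₁ + L (k * k₁) + t₂, ?_, ?_⟩
            · simpa using Collapse.pair (s := s₀) (hu.append h1) h2
            · have := hL.map_mul k k₁
              rw [inv_mul_cancel, hL.map_one]
              omega
        · simp only [List.cons_append, List.cons.injEq] at hl
          obtain ⟨rfl, hl⟩ := hl
          rcases l with _ | ⟨b, l⟩
          · simp only [List.nil_append, List.cons.injEq] at hl
            obtain ⟨hs, rfl⟩ := hl
            have : s₀ = s := by
              rw [← invLetter_invLetter s₀, ← hs, invLetter_invLetter]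
            subst this
            -- The inner block ends in `s₀`, which cancels against the closing letter, so the
            -- opening `s₀` must inherit the role of that last letter.
            rcases hu.concat_inversion rfl with
              ⟨g', r', k', t', h1, h2, rfl, rfl⟩ | ⟨u', v, k₁, t₁, t₂, rfl, h1, h2, rfl⟩
            · refine ⟨_, _, .cons h1 (h2.append hw), ?_⟩
              have e : (g' * (k' * h))⁻¹ * h = h⁻¹ * (g' * k')⁻¹ * h := by group
              rw [e, hL.map_conj', hL.map_inv, hL.map_mul_comm]
              omega
            · refine ⟨k₁ * h, t₁ + L k + (t₂ + t'), ?_, ?_⟩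
              · simpa using Collapse.pair (s := s₀) h1 (h2.append hw)
              · have e : (k₁ * h)⁻¹ * h = h⁻¹ * k₁⁻¹ * h := by group
                rw [e, hL.map_conj', hL.map_inv]
                omega
          · simp only [List.cons_append, List.cons.injEq] at hl
            obtain ⟨rfl, rfl⟩ := hl
            obtain ⟨g', r', h1, h2⟩ := ih1 rfl
            refine ⟨h, r' + L g' + t', by simpa using Collapse.pair (s := s₀) h1 hw, ?_⟩
            have h3 := hL.map_mul k (g'⁻¹ * k)⁻¹
            have e : k * (g'⁻¹ * k)⁻¹ = g' := by group
            rw [e, hL.map_inv] at h3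
            rw [inv_mul_cancel, hL.map_one]
            omega

end Collapse

/-! ### The norm induced on the free group -/

namespace Collapse

variable {α G : Type*} [Group G] {L : G → ℕ} {C : α × Bool → G → ℕ → Prop}

/-- The least cost of turning the word `w` into the identity. -/
noncomputable def wordNorm (L : G → ℕ) (C : α × Bool → G → ℕ → Prop) (w : List (α × Bool)) : ℕ :=
  sInf {n | ∃ g r, Collapse L C w g r ∧ n = r + L g}

theorem wordNorm_le {w : List (α × Bool)} {g : G} {r : ℕ} (h : Collapse L C w g r) :
    wordNorm L C w ≤ r + L g :=
  Nat.sInf_le ⟨g, r, h, rfl⟩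

theorem exists_wordNorm_eq (hC : IsReplacement L C) (w : List (α × Bool)) :
    ∃ g r, Collapse L C w g r ∧ wordNorm L C w = r + L g := by
  obtain ⟨g, r, h⟩ := exists_of_total hC w
  exact Nat.sInf_mem (s := {n | ∃ g r, Collapse L C w g r ∧ n = r + L g}) ⟨_, g, r, h, rfl⟩

/-- Thanks to this, the norm axioms need checking only on unreduced concatenations of words. -/
theorem wordNorm_le_of_red (hL : IsInvNorm L) (hC : IsReplacement L C) {u v : List (α × Bool)}
    (h : FreeGroup.Red u v) : wordNorm L C v ≤ wordNorm L C u := by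
  induction h with
  | refl => rfl
  | tail _ hs ih =>
    refine le_trans ?_ ih
    cases hs with
    | @not u v x b =>
      obtain ⟨g, r, h, e⟩ := exists_wordNorm_eq hC (u ++ (x, b) :: (x, !b) :: v)
      obtain ⟨g', r', h', hle⟩ := h.cancel hL hC (s := (x, b)) rfl
      refine (wordNorm_le h').trans ?_
      have := hL.map_mul g (g'⁻¹ * g)⁻¹
      rw [show g * (g'⁻¹ * g)⁻¹ = g' by group, hL.map_inv] at this
      omega

theorem wordNorm_append_le (hL : IsInvNorm L) (hC : IsReplacement L C) (u v : List (α × Bool)) :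
    wordNorm L C (u ++ v) ≤ wordNorm L C u + wordNorm L C v := by
  obtain ⟨g, r, h, e⟩ := exists_wordNorm_eq hC u
  obtain ⟨g', r', h', e'⟩ := exists_wordNorm_eq hC v
  refine (wordNorm_le (h.append h')).trans ?_
  have := hL.map_mul g g'
  omega

theorem wordNorm_invRev_le (hL : IsInvNorm L) (hC : IsReplacement L C) (u : List (α × Bool)) :
    wordNorm L C (FreeGroup.invRev u) ≤ wordNorm L C u := by
  obtain ⟨g, r, h, e⟩ := exists_wordNorm_eq hC u
  refine (wordNorm_le (h.invRev hL hC)).trans ?_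
  rw [e, hL.map_inv]

/-- Each outer pair of conjugating letters is removed by one deletion, whose cost is exactly that of
collapsing the inside to the identity. -/
theorem wordNorm_conj_le (hL : IsInvNorm L) (hC : IsReplacement L C) (c u : List (α × Bool)) :
    wordNorm L C (c ++ u ++ FreeGroup.invRev c) ≤ wordNorm L C u := by
  induction c with
  | nil => simp [FreeGroup.invRev]
  | cons s c ih =>
    refine le_trans ?_ ih
    obtain ⟨g, r, h, e⟩ := exists_wordNorm_eq hC (c ++ u ++ FreeGroup.invRev c)
    have h' := wordNorm_le (Collapse.pair (s := s) h .nil)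
    rw [hL.map_one] at h'
    rw [invRev_cons']
    simp only [List.append_assoc, List.cons_append] at h' e ⊢
    omega

variable [DecidableEq α]

/-- The norm on the free group induced by a replacement relation. -/
noncomputable def freeNorm (L : G → ℕ) (C : α × Bool → G → ℕ → Prop) (w : FreeGroup α) : ℕ :=
  wordNorm L C w.toWord

theorem freeNorm_conj_le (hL : IsInvNorm L) (hC : IsReplacement L C) (c u : FreeGroup α) :
    freeNorm L C (c * u * c⁻¹) ≤ freeNorm L C u := by
  refine le_trans ?_ (wordNorm_conj_le hL hC c.toWord u.toWord)
  have : FreeGroup.Red (c.toWord ++ u.toWord ++ FreeGroup.invRev c.toWord)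
      (c * u * c⁻¹).toWord := by
    have e : c * u * c⁻¹ = FreeGroup.mk (c.toWord ++ u.toWord ++ FreeGroup.invRev c.toWord) := by
      simp only [← FreeGroup.mul_mk, ← FreeGroup.inv_mk, FreeGroup.mk_toWord]
    rw [e, FreeGroup.toWord_mk]
    exact FreeGroup.reduce.red
  exact wordNorm_le_of_red hL hC this

theorem isInvNorm_freeNorm (hL : IsInvNorm L) (hC : IsReplacement L C)
    (hpos : ∀ w : FreeGroup α, freeNorm L C w = 0 → w = 1) :
    IsInvNorm (freeNorm L C : FreeGroup α → ℕ) where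
  map_one := by
    have := wordNorm_le (L := L) (C := C) .nil
    rw [hL.map_one] at this
    simpa [freeNorm] using this
  eq_one := hpos
  map_inv w := by
    refine le_antisymm ?_ ?_
    · simpa [freeNorm, FreeGroup.toWord_inv] using wordNorm_invRev_le hL hC w.toWord
    · simpa [freeNorm, FreeGroup.toWord_inv] using
        wordNorm_invRev_le hL hC (FreeGroup.invRev w.toWord)
  map_mul u v := by
    refine le_trans ?_ (wordNorm_append_le hL hC u.toWord v.toWord)
    refine wordNorm_le_of_red hL hC ?_
    rw [FreeGroup.toWord_mul]
    exact FreeGroup.reduce.red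
  map_conj c u := by
    refine le_antisymm (freeNorm_conj_le hL hC c u) ?_
    have := freeNorm_conj_le hL hC c⁻¹ (c * u * c⁻¹)
    rwa [show c⁻¹ * (c * u * c⁻¹) * c⁻¹⁻¹ = u by group] at this

end Collapse

/-! ### One-point extension of an integral norm -/

/-- Letters other than `x` are kept for free; the letter `x` may be replaced by `a ∈ A` at
cost `f a`. -/
inductive LetterCost {α : Type*} (A : Set (FreeGroup α)) (f : FreeGroup α → ℕ) (x : α) :
    α × Bool → FreeGroup α → ℕ → Prop
  | keep {i b} : i ≠ x → LetterCost A f x (i, b) (FreeGroup.mk [(i, b)]) 0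
  | pos {a} : a ∈ A → LetterCost A f x (x, true) a (f a)
  | neg {a} : a ∈ A → LetterCost A f x (x, false) a⁻¹ (f a)

namespace LetterCost

variable {α : Type*} {A : Set (FreeGroup α)} {f L : FreeGroup α → ℕ} {x : α}

theorem isReplacement (hL : IsInvNorm L) (hA : A.Nonempty)
    (hf : ∀ a ∈ A, ∀ b ∈ A, L (a * b⁻¹) ≤ f a + f b) : IsReplacement L (LetterCost A f x) where
  total := by
    classical
    rintro ⟨i, b⟩
    by_cases hi : i = x
    · subst hi
      obtain ⟨a, ha⟩ := hA
      cases b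
      · exact ⟨_, _, .neg ha⟩
      · exact ⟨_, _, .pos ha⟩
    · exact ⟨_, _, .keep hi⟩
  inv := by
    rintro s g r (h | h | h)
    · simpa [FreeGroup.invRev, invLetter] using LetterCost.keep (A := A) (f := f) h
    · exact .neg h
    · simpa [invLetter] using LetterCost.pos (f := f) (x := x) h
  cancel := by
    rintro s g h r t h1 h2
    cases h1 with
    | @keep i b hi =>
      generalize hs : invLetter (i, b) = s' at h2
      cases h2 with
      | keep hj =>
        simp only [invLetter, Prod.mk.injEq] at hs
        obtain ⟨rfl, rfl⟩ := hs
        have : FreeGroup.mk [(i, b)] * FreeGroup.mk [(i, !b)] = 1 := by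
          have : FreeGroup.mk [(i, !b)] = (FreeGroup.mk [(i, b)])⁻¹ := by simp [FreeGroup.invRev]
          rw [this, mul_inv_cancel]
        rw [this, hL.map_one]
        omega
      | pos => simp [invLetter, hi] at hs
      | neg => simp [invLetter, hi] at hs
    | pos ha =>
      generalize hs : invLetter (x, true) = s' at h2
      cases h2 with
      | keep hj => simp [invLetter, hj.symm] at hs
      | pos => simp [invLetter] at hs
      | neg hb => exact hf _ ha _ hb
    | neg ha =>
      generalize hs : invLetter (x, false) = s' at h2
      cases h2 with
      | keep hj => simp [invLetter, hj.symm] at hs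
      | pos hb =>
        rw [hL.map_mul_comm, add_comm]
        exact hf _ hb _ ha
      | neg => simp [invLetter] at hs

/-- At cost zero no `x` is replaced and only conjugates of the identity are deleted. This gives
definiteness of the new norm. -/
theorem mk_eq_of_collapse_zero (hL : IsInvNorm L) (hpos : ∀ a ∈ A, 0 < f a)
    {w : List (α × Bool)} {g : FreeGroup α} {r : ℕ} (h : Collapse L (LetterCost A f x) w g r)
    (hr : r = 0) : FreeGroup.mk w = g := by
  induction h with
  | nil => rfl
  | @cons s w g h r t hc _ ih =>
    have h1 := ih (by omega)
    cases hc with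
    | keep hi => rw [← h1, FreeGroup.mul_mk]; rfl
    | pos ha => have := hpos _ ha; omega
    | neg ha => have := hpos _ ha; omega
  | @pair s u w k h t t' _ _ ih1 ih2 =>
    have h1 := ih1 (by omega)
    have h2 := ih2 (by omega)
    rw [hL.eq_one k (by omega)] at h1
    have e : s :: (u ++ invLetter s :: w) = [s] ++ u ++ FreeGroup.invRev [s] ++ w := by
      simp [FreeGroup.invRev, invLetter]
    rw [e, ← FreeGroup.mul_mk, ← FreeGroup.mul_mk, ← FreeGroup.mul_mk, ← FreeGroup.inv_mk, h1, h2]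
    group

/-- Without `x`, only deletions move the group element, each by at most its price. Hence the new
norm is not smaller than `L` on words without `x`. -/
theorem dist_le_of_collapse (hL : IsInvNorm L) {w : List (α × Bool)} {g : FreeGroup α} {r : ℕ}
    (h : Collapse L (LetterCost A f x) w g r) (hw : ∀ s ∈ w, s.1 ≠ x) :
    L (g⁻¹ * FreeGroup.mk w) ≤ r := by
  induction h with
  | nil => simp [← FreeGroup.one_eq_mk, hL.map_one]
  | @cons s w g h r t hc _ ih =>
    have h1 := ih fun s hs => hw s (by simp [hs])
    have h2 := hw s (by simp)
    cases hc with
    | @keep i b hi =>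
      have e : FreeGroup.mk ((i, b) :: w) = FreeGroup.mk [(i, b)] * FreeGroup.mk w := by
        rw [FreeGroup.mul_mk]; rfl
      rw [e, mul_inv_rev, mul_assoc, inv_mul_cancel_left]
      omega
    | pos ha => exact absurd rfl h2
    | neg ha => exact absurd rfl h2
  | @pair s u w k h t t' _ _ ih1 ih2 =>
    have h1 := ih1 fun s hs => hw s (by simp [hs])
    have h2 := ih2 fun s hs => hw s (by simp [hs])
    have e : s :: (u ++ invLetter s :: w) = [s] ++ u ++ FreeGroup.invRev [s] ++ w := by
      simp [FreeGroup.invRev, invLetter]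
    rw [e, ← FreeGroup.mul_mk, ← FreeGroup.mul_mk, ← FreeGroup.mul_mk, ← FreeGroup.inv_mk]
    generalize FreeGroup.mk w = W at *
    generalize FreeGroup.mk u = U at *
    generalize FreeGroup.mk [s] = S
    have h3 := hL.map_mul k (k⁻¹ * U)
    rw [mul_inv_cancel_left] at h3
    have h4 := hL.map_mul (h⁻¹ * (S * U * S⁻¹) * h) (h⁻¹ * W)
    rw [hL.map_conj', hL.map_conj] at h4
    rw [show h⁻¹ * (S * U * S⁻¹ * W) = (h⁻¹ * (S * U * S⁻¹) * h) * (h⁻¹ * W) by group]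
    omega

theorem collapse_mk {w : List (α × Bool)} (hw : ∀ s ∈ w, s.1 ≠ x) :
    Collapse L (LetterCost A f x) w (FreeGroup.mk w) 0 := by
  induction w with
  | nil => exact .nil
  | cons s w ih =>
    have h := Collapse.cons (LetterCost.keep (A := A) (f := f) (b := s.2) (hw s (by simp)))
      (ih fun s hs => hw s (by simp [hs]))
    rwa [FreeGroup.mul_mk] at h

end LetterCost

open Collapse in
/-- An integral invariant norm on a free group can be modified on the words that involve the
letter `x` so that the distances of `x` from a finite set are prescribed. -/
theorem IsInvNorm.exists_extension {α : Type*} [DecidableEq α] {L : FreeGroup α → ℕ}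
    (hL : IsInvNorm L) (x : α) {A : Set (FreeGroup α)} (hA : A.Nonempty) (f : FreeGroup α → ℕ)
    (hx : ∀ a ∈ A, ∀ s ∈ a.toWord, s.1 ≠ x) (hpos : ∀ a ∈ A, 0 < f a)
    (hadd : ∀ a ∈ A, ∀ b ∈ A, L (a * b⁻¹) ≤ f a + f b)
    (hlip : ∀ a ∈ A, ∀ b ∈ A, f a ≤ f b + L (a * b⁻¹)) :
    ∃ N : FreeGroup α → ℕ, IsInvNorm N ∧
      (∀ w : FreeGroup α, (∀ s ∈ w.toWord, s.1 ≠ x) → N w = L w) ∧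
      ∀ a ∈ A, N (FreeGroup.of x * a⁻¹) = f a := by
  have hC := LetterCost.isReplacement (x := x) hL hA hadd
  refine ⟨freeNorm L (LetterCost A f x), isInvNorm_freeNorm hL hC ?_, ?_, ?_⟩
  · intro w hw
    obtain ⟨g, r, h, e⟩ := exists_wordNorm_eq hC w.toWord
    rw [freeNorm, e] at hw
    have h1 := LetterCost.mk_eq_of_collapse_zero hL hpos h (by omega)
    rwa [hL.eq_one g (by omega), FreeGroup.mk_toWord] at h1
  · intro w hw
    refine le_antisymm ?_ ?_
    · simpa [FreeGroup.mk_toWord, freeNorm] using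
        wordNorm_le (L := L) (LetterCost.collapse_mk (A := A) (f := f) hw)
    · obtain ⟨g, r, h, e⟩ := exists_wordNorm_eq hC w.toWord
      have h1 := LetterCost.dist_le_of_collapse hL h hw
      have h2 := hL.map_mul g (g⁻¹ * w)
      rw [mul_inv_cancel_left] at h2
      rw [FreeGroup.mk_toWord] at h1
      rw [freeNorm, e]
      omega
  · intro a ha
    have hw : ∀ s ∈ a⁻¹.toWord, s.1 ≠ x := by
      intro s hs
      rw [FreeGroup.toWord_inv] at hs
      simp only [FreeGroup.invRev, List.mem_reverse, List.mem_map] at hs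
      obtain ⟨s', hs', rfl⟩ := hs
      exact hx a ha s' hs'
    have hword : (FreeGroup.of x * a⁻¹).toWord = (x, true) :: a⁻¹.toWord := by
      rw [FreeGroup.toWord_mul, FreeGroup.toWord_of]
      apply FreeGroup.IsReduced.reduce_eq
      have h0 : FreeGroup.IsReduced a⁻¹.toWord := FreeGroup.isReduced_toWord
      cases hu : a⁻¹.toWord with
      | nil => simp
      | cons s u =>
        rw [hu] at h0 hw
        rw [List.singleton_append, FreeGroup.isReduced_cons_cons]
        exact ⟨fun h => absurd h.symm (hw s (by simp)), h0⟩
    refine le_antisymm ?_ ?_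
    · have := wordNorm_le (L := L) (Collapse.cons (LetterCost.pos (f := f) (x := x) ha)
        (LetterCost.collapse_mk (A := A) (f := f) hw))
      rw [FreeGroup.mk_toWord, mul_inv_cancel, hL.map_one] at this
      simpa [freeNorm, hword] using this
    · obtain ⟨g, r, h, e⟩ := exists_wordNorm_eq hC (FreeGroup.of x * a⁻¹).toWord
      rw [freeNorm, e]
      rw [hword] at h
      -- The letter `x` occurs only at the front, so it cannot be deleted in a pair. It is replaced
      -- by some `b` at cost `f b`, and `hlip` compares `f b` with `f a`.
      rcases h.cons_inversion with
        ⟨b, r', k', t', h1, h2, rfl, rfl⟩ | ⟨u, v, k₁, t₁, t₂, hu, _⟩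
      · have h3 := LetterCost.dist_le_of_collapse hL h2 hw
        rw [FreeGroup.mk_toWord] at h3
        cases h1 with
        | keep hi => exact absurd rfl hi
        | pos hb =>
          have h4 := hlip a ha b hb
          rw [← hL.map_inv] at h4
          have h5 := hL.map_mul (b * k') (k'⁻¹ * a⁻¹)
          rw [show b * k' * (k'⁻¹ * a⁻¹) = (a * b⁻¹)⁻¹ by group] at h5
          omega
      · exact absurd rfl (hw (invLetter (x, true)) (by simp [hu]))

/-! ### The generic rational norm -/

/-- A rational invariant norm on `FreeGroup ℕ` whose values have a common denominator. -/
structure IsRatNorm (l : FreeGroup ℕ → ℚ) : Prop where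
  isInvNorm : IsInvNorm l
  exists_denom : ∃ q : ℕ, 0 < q ∧ ∀ w, ∃ k : ℕ, (q : ℚ) * l w = k

/-- The function `p` on its support is a possible function of distances to a new point, with respect
to the metric defined by `l`. -/
structure IsAdmissible (l : FreeGroup ℕ → ℚ) (p : FreeGroup ℕ →₀ ℚ) : Prop where
  nonempty : p.support.Nonempty
  nonneg : ∀ a ∈ p.support, 0 ≤ p a
  le_add : ∀ a ∈ p.support, ∀ b ∈ p.support, l (a * b⁻¹) ≤ p a + p b
  lipschitz : ∀ a ∈ p.support, ∀ b ∈ p.support, p a ≤ p b + l (a * b⁻¹)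

/-- All letters of `w` are less than `n`. -/
def LettersLT (n : ℕ) (w : FreeGroup ℕ) : Prop := ∀ s ∈ w.toWord, s.1 < n

theorem LettersLT.mono {n m : ℕ} {w : FreeGroup ℕ} (h : LettersLT n w) (hnm : n ≤ m) :
    LettersLT m w := fun s hs => (h s hs).trans_le hnm

theorem exists_lettersLT (w : FreeGroup ℕ) : ∃ n, LettersLT n w :=
  ⟨(w.toWord.map fun s => s.1 + 1).sum, fun s hs => by
    have : s.1 + 1 ∈ w.toWord.map fun s => s.1 + 1 := List.mem_map.2 ⟨s, hs, rfl⟩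
    have := List.le_sum_of_mem this
    omega⟩

theorem isRatNorm_discrete : IsRatNorm fun w => if w = 1 then 0 else 1 where
  isInvNorm :=
    { map_one := by simp
      eq_one := by intro g; simp
      map_inv := by simp
      map_mul := by
        intro g h
        by_cases hg : g = 1
        · simp [hg]
        · by_cases hh : h = 1
          · simp [hh]
          · simp only [hg, hh, if_false]
            split_ifs <;> norm_num
      map_conj := by
        intro c g
        simp }
  exists_denom := ⟨1, one_pos, fun w => by
    by_cases hw : w = 1
    · exact ⟨0, by simp [hw]⟩
    · exact ⟨1, by simp [hw]⟩⟩

theorem IsRatNorm.exists_step {l : FreeGroup ℕ → ℚ} (hl : IsRatNorm l) (n : ℕ)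
    (p : FreeGroup ℕ →₀ ℚ) :
    ∃ l', IsRatNorm l' ∧ (∀ w, LettersLT n w → l' w = l w) ∧
      (IsAdmissible l p → (∀ a ∈ p.support, LettersLT n a) →
        ∀ a ∈ p.support, l' (FreeGroup.of n * a⁻¹) = p a) := by
  classical
  by_cases h : IsAdmissible l p ∧ ∀ a ∈ p.support, LettersLT n a
  swap
  · exact ⟨l, hl, fun _ _ => rfl, fun h1 h2 => absurd ⟨h1, h2⟩ h⟩
  obtain ⟨hp, hn⟩ := h
  obtain ⟨q, hq, hk⟩ := hl.exists_denom
  obtain ⟨Q, hQ, hQl, hQp⟩ : ∃ Q : ℕ, 0 < Q ∧ (∀ w, ∃ k : ℕ, (Q : ℚ) * l w = k) ∧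
      ∀ a, a ∈ p.support → ∃ k : ℕ, (Q : ℚ) * p a = k := by
    -- `Q` clears the denominators of all values of `l` and `p` at once, so the integral extension
    -- applies.
    refine ⟨q * ∏ a ∈ p.support, (p a).den,
      Nat.mul_pos hq (Finset.prod_pos fun a _ => (p a).den_pos), fun w => ?_, fun a ha => ?_⟩
    · obtain ⟨k, hk⟩ := hk w
      refine ⟨(∏ a ∈ p.support, (p a).den) * k, ?_⟩
      push_cast [← hk]
      ring
    · obtain ⟨m, hm⟩ := Finset.dvd_prod_of_mem (fun a => (p a).den) ha
      refine ⟨q * m * (p a).num.natAbs, ?_⟩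
      rw [hm]
      have h1 : ((p a).num.natAbs : ℚ) = (p a).num := by
        have : ((p a).num.natAbs : ℤ) = (p a).num :=
          Int.natAbs_of_nonneg (Rat.num_nonneg.2 (hp.nonneg a ha))
        rw [← Int.cast_natCast, this]
      have h2 := Rat.mul_den_eq_num (p a)
      push_cast [h1, ← h2]
      ring
  have hQ' : (0 : ℚ) < Q := by exact_mod_cast hQ
  choose L hL using hQl
  choose! f hf using hQp
  have hLn : IsInvNorm L :=
    { map_one := by
        have := hL 1
        rw [hl.isInvNorm.map_one, mul_zero] at this
        exact_mod_cast this.symm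
      eq_one := by
        intro g hg
        have := hL g
        rw [hg, Nat.cast_zero, mul_eq_zero] at this
        exact hl.isInvNorm.eq_one g (this.resolve_left hQ'.ne')
      map_inv := by
        intro g
        have := hL g⁻¹
        rw [hl.isInvNorm.map_inv, hL] at this
        exact_mod_cast this.symm
      map_mul := by
        intro g h
        have := mul_le_mul_of_nonneg_left (hl.isInvNorm.map_mul g h) hQ'.le
        rw [mul_add, hL, hL, hL] at this
        exact_mod_cast this
      map_conj := by
        intro c g
        have := hL (c * g * c⁻¹)
        rw [hl.isInvNorm.map_conj, hL] at this
        exact_mod_cast this.symm }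
  obtain ⟨N, hN, hNL, hNf⟩ := hLn.exists_extension n (A := p.support) hp.nonempty f
    (fun a ha s hs => (hn a ha s hs).ne)
    (fun a ha => by
      have h1 : 0 < p a := lt_of_le_of_ne (hp.nonneg a ha) (Finsupp.mem_support_iff.1 ha).symm
      have h2 : (0 : ℚ) < f a := by rw [← hf a ha]; positivity
      exact_mod_cast h2)
    (fun a ha b hb => by
      have := mul_le_mul_of_nonneg_left (hp.le_add a ha b hb) hQ'.le
      rw [mul_add, hL, hf a ha, hf b hb] at this
      exact_mod_cast this)
    (fun a ha b hb => by
      have := mul_le_mul_of_nonneg_left (hp.lipschitz a ha b hb) hQ'.le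
      rw [mul_add, hL, hf a ha, hf b hb] at this
      exact_mod_cast this)
  refine ⟨fun w => N w / Q, ⟨?_, Q, hQ, fun w => ⟨N w, by field_simp⟩⟩, fun w hw => ?_,
    fun _ _ a ha => ?_⟩
  · exact
    { map_one := by simp [hN.map_one]
      eq_one := by
        intro g hg
        refine hN.eq_one g ?_
        rw [div_eq_zero_iff] at hg
        exact_mod_cast hg.resolve_right hQ'.ne'
      map_inv := by intro g; rw [hN.map_inv]
      map_mul := by
        intro g h
        rw [← add_div]
        gcongr
        exact_mod_cast hN.map_mul g h
      map_conj := by intro c g; rw [hN.map_conj] }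
  · beta_reduce
    rw [hNL w fun s hs => (hw s hs).ne, ← hL]
    field_simp
  · beta_reduce
    rw [hNf a ha, ← hf a ha]
    field_simp

/-- There is a rational invariant norm on `FreeGroup ℕ` for which all admissible distances to
finite sets are realized. -/
theorem exists_generic_norm : ∃ l : FreeGroup ℕ → ℚ, IsInvNorm l ∧
    ∀ p : FreeGroup ℕ →₀ ℚ, IsAdmissible l p → ∃ z, ∀ a ∈ p.support, l (z * a⁻¹) = p a := by
  have : Countable (FreeGroup ℕ) := FreeGroup.toWord_injective.countable
  obtain ⟨e, he⟩ := exists_surjective_nat (FreeGroup ℕ →₀ ℚ)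
  -- Stage `n` treats the first component of the pair coded by `n`, so every `p` is treated at
  -- infinitely many stages.
  choose S hS hS_eq hS_dist using fun (l : {l // IsRatNorm l}) (n : ℕ) =>
    l.2.exists_step n (e n.unpair.1)
  let seq : ℕ → {l // IsRatNorm l} :=
    fun n => Nat.rec ⟨_, isRatNorm_discrete⟩ (fun n l => ⟨S l n, hS l n⟩) n
  have hseq : ∀ n, (seq (n + 1)).1 = S (seq n) n := fun n => rfl
  have hstable : ∀ n m w, n ≤ m → LettersLT n w → (seq m).1 w = (seq n).1 w := by
    intro n m w hnm hw
    induction m, hnm using Nat.le_induction with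
    | base => rfl
    | succ m hm ih => rw [hseq, hS_eq _ _ _ (hw.mono hm), ih]
  choose bd hbd using exists_lettersLT
  -- Stage `n` leaves words in letters below `n` unchanged, so the values at `w` are constant from
  -- stage `bd w` on.
  let l : FreeGroup ℕ → ℚ := fun w => (seq (bd w)).1 w
  have hl : ∀ w n, bd w ≤ n → l w = (seq n).1 w := fun w n h => (hstable _ _ _ h (hbd w)).symm
  refine ⟨l, ?_, ?_⟩
  · exact
    { map_one := (seq _).2.isInvNorm.map_one
      eq_one := fun g hg => (seq _).2.isInvNorm.eq_one g hg
      map_inv := fun g => by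
        rw [hl g (max (bd g) (bd g⁻¹)) (by simp), hl g⁻¹ (max (bd g) (bd g⁻¹)) (by simp)]
        exact (seq _).2.isInvNorm.map_inv g
      map_mul := fun g h => by
        have hn : ∃ n, bd g ≤ n ∧ bd h ≤ n ∧ bd (g * h) ≤ n :=
          ⟨max (bd g) (max (bd h) (bd (g * h))), by simp⟩
        obtain ⟨n, h1, h2, h3⟩ := hn
        rw [hl _ n h1, hl _ n h2, hl _ n h3]
        exact (seq _).2.isInvNorm.map_mul g h
      map_conj := fun c g => by
        rw [hl g (max (bd g) (bd (c * g * c⁻¹))) (by simp),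
          hl (c * g * c⁻¹) (max (bd g) (bd (c * g * c⁻¹))) (by simp)]
        exact (seq _).2.isInvNorm.map_conj c g }
  · intro p hp
    obtain ⟨i, rfl⟩ := he p
    set p := e i
    -- From stage `m` on, the support avoids the generator being treated and all its mutual
    -- distances are final. The pairing gives a stage `n ≥ m` that treats `p`.
    let m : ℕ := max (p.support.sup bd)
      ((p.support ×ˢ p.support).sup fun ab => bd (ab.1 * ab.2⁻¹))
    let n : ℕ := Nat.pair i m
    have hmn : m ≤ n := Nat.right_le_pair i m
    have hen : e n.unpair.1 = p := by simp [n, p]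
    have hlt : ∀ a ∈ p.support, LettersLT n a := fun a ha =>
      (hbd a).mono ((Finset.le_sup (f := bd) ha).trans ((le_max_left _ _).trans hmn))
    have hll : ∀ a ∈ p.support, ∀ b ∈ p.support, l (a * b⁻¹) = (seq n).1 (a * b⁻¹) := by
      intro a ha b hb
      refine hl _ _ (le_trans ?_ ((le_max_right _ _).trans hmn))
      exact Finset.le_sup (f := fun ab : FreeGroup ℕ × FreeGroup ℕ => bd (ab.1 * ab.2⁻¹))
        (Finset.mk_mem_product ha hb)
    have hadm : IsAdmissible (seq n).1 p :=
      { nonempty := hp.nonempty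
        nonneg := hp.nonneg
        le_add := fun a ha b hb => hll a ha b hb ▸ hp.le_add a ha b hb
        lipschitz := fun a ha b hb => hll a ha b hb ▸ hp.lipschitz a ha b hb }
    refine ⟨FreeGroup.of n, fun a ha => ?_⟩
    have key := hS_dist (seq n) n
    rw [hen] at key
    rw [← key hadm hlt a ha, ← hseq]
    have hw : LettersLT (n + 1) (FreeGroup.of n * a⁻¹) := by
      intro s hs
      have := (FreeGroup.toWord_mul_sublist _ _).subset hs
      rw [List.mem_append, FreeGroup.toWord_of, FreeGroup.toWord_inv, FreeGroup.invRev,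
        List.mem_reverse, List.mem_map] at this
      rcases this with h | ⟨s', hs', rfl⟩
      · simp at h; simp [h]
      · exact (hlt a ha s' hs').trans (Nat.lt_succ_self n)
    rw [hl _ (max (bd (FreeGroup.of n * a⁻¹)) (n + 1)) (le_max_left _ _)]
    exact hstable _ _ _ (le_max_right _ _) hw

/-! ### The extension property and universality -/

/-- Every admissible function with values in `V` on a finite family of points of `X` is the distance
function of some point of `X`. -/
def ExtensionProperty (V : Set ℝ) (X : Type) [MetricSpace X] : Prop :=
  ∀ (ι : Type) [Finite ι] (p : ι → X) (r : ι → ℝ), (∀ i, r i ∈ V) →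
    (∀ i j, dist (p i) (p j) ≤ r i + r j) → (∀ i j, r i ≤ r j + dist (p i) (p j)) →
    ∃ y, ∀ i, dist y (p i) = r i

namespace ExtensionProperty

variable {V : Set ℝ} {X : Type} [MetricSpace X]

theorem nonempty (hX : ExtensionProperty V X) : Nonempty X :=
  ⟨(hX Empty (fun e => e.elim) (fun e => e.elim) (fun e => e.elim)
    (fun e => e.elim) (fun e => e.elim)).choose⟩

/-- A finite partial isometry from a metric space with distances in `V` extends to one more
point. -/
theorem exists_dist_eq (hX : ExtensionProperty V X) {Y ι : Type} [MetricSpace Y]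
    (hY : ∀ x y : Y, dist x y ∈ V) [Finite ι] (q : ι → Y) (p : ι → X)
    (hpq : ∀ i j, dist (p i) (p j) = dist (q i) (q j)) (t : Y) :
    ∃ y, ∀ i, dist y (p i) = dist t (q i) := by
  refine hX ι p (fun i => dist t (q i)) (fun i => hY _ _) (fun i j => ?_) (fun i j => ?_)
  · rw [hpq]
    exact dist_triangle_left _ _ _
  · rw [hpq, dist_comm (q i)]
    exact dist_triangle _ _ _

theorem exists_isometry (hX : ExtensionProperty V X) (F : Type) [Finite F] [MetricSpace F]
    (hF : ∀ x y : F, dist x y ∈ V) : ∃ i : F → X, Isometry i := by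
  classical
  have : Fintype F := Fintype.ofFinite F
  obtain ⟨x₀⟩ := hX.nonempty
  have key : ∀ s : Finset F, ∃ i : F → X, ∀ a ∈ s, ∀ b ∈ s, dist (i a) (i b) = dist a b := by
    intro s
    induction s using Finset.induction_on with
    | empty => exact ⟨fun _ => x₀, by simp⟩
    | insert t s ht ih =>
      obtain ⟨i, hi⟩ := ih
      obtain ⟨y, hy⟩ := hX.exists_dist_eq hF (ι := s) (fun a => (a : F)) (fun a => i a)
        (fun a b => hi a a.2 b b.2) t
      have hne : ∀ a ∈ s, a ≠ t := fun a ha h => ht (h ▸ ha)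
      refine ⟨Function.update i t y, fun a ha b hb => ?_⟩
      rw [Finset.mem_insert] at ha hb
      rcases ha with rfl | ha <;> rcases hb with rfl | hb
      · simp
      · rw [Function.update_self, Function.update_of_ne (hne b hb)]
        exact hy ⟨b, hb⟩
      · rw [Function.update_self, Function.update_of_ne (hne a ha), dist_comm, dist_comm a]
        exact hy ⟨a, ha⟩
      · rw [Function.update_of_ne (hne a ha), Function.update_of_ne (hne b hb), hi a ha b hb]
  obtain ⟨i, hi⟩ := key Finset.univ
  exact ⟨i, Isometry.of_dist_eq fun a b => hi a (Finset.mem_univ _) b (Finset.mem_univ _)⟩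

end ExtensionProperty

/-! ### Back and forth and ultrahomogeneity -/

/-- A relation on `X` which preserves distances. -/
def IsIsometric {X : Type} [MetricSpace X] (S : Set (X × X)) : Prop :=
  ∀ p ∈ S, ∀ q ∈ S, dist p.1 q.1 = dist p.2 q.2

namespace IsIsometric

variable {V : Set ℝ} {X : Type} [MetricSpace X] {S : Set (X × X)}

theorem exists_insert_fst (hS : IsIsometric S) (hX : ExtensionProperty V X)
    (hV : ∀ x y : X, dist x y ∈ V) (hfin : S.Finite) (x : X) :
    ∃ y, IsIsometric (insert (x, y) S) := by
  have : Finite S := hfin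
  obtain ⟨y, hy⟩ := hX.exists_dist_eq hV (ι := S) (fun p => p.1.1) (fun p => p.1.2)
    (fun p q => (hS p p.2 q q.2).symm) x
  refine ⟨y, ?_⟩
  rintro p (rfl | hp) q (rfl | hq)
  · simp
  · exact (hy ⟨q, hq⟩).symm
  · rw [dist_comm, dist_comm p.2]
    exact (hy ⟨p, hp⟩).symm
  · exact hS p hp q hq

theorem exists_insert_snd (hS : IsIsometric S) (hX : ExtensionProperty V X)
    (hV : ∀ x y : X, dist x y ∈ V) (hfin : S.Finite) (y : X) :
    ∃ x, IsIsometric (insert (x, y) S) := by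
  have : Finite S := hfin
  obtain ⟨x, hx⟩ := hX.exists_dist_eq hV (ι := S) (fun p => p.1.2) (fun p => p.1.1)
    (fun p q => hS p p.2 q q.2) y
  refine ⟨x, ?_⟩
  rintro p (rfl | hp) q (rfl | hq)
  · simp
  · exact hx ⟨q, hq⟩
  · rw [dist_comm, dist_comm p.2]
    exact hx ⟨p, hp⟩
  · exact hS p hp q hq

/-- Back and forth: a finite isometric relation extends to one whose domain and range contain a
given sequence. -/
theorem exists_back_and_forth (hS : IsIsometric S) (hX : ExtensionProperty V X)
    (hV : ∀ x y : X, dist x y ∈ V) (hfin : S.Finite) (u : ℕ → X) :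
    ∃ T, S ⊆ T ∧ IsIsometric T ∧ (∀ n, ∃ y, (u n, y) ∈ T) ∧ ∀ n, ∃ x, (x, u n) ∈ T := by
  have step : ∀ (T : {T : Set (X × X) // IsIsometric T ∧ T.Finite}) (n : ℕ),
      ∃ T' : {T : Set (X × X) // IsIsometric T ∧ T.Finite},
        T.1 ⊆ T'.1 ∧ (∃ y, (u n, y) ∈ T'.1) ∧ ∃ x, (x, u n) ∈ T'.1 := by
    rintro ⟨T, hT, hTf⟩ n
    obtain ⟨y, hy⟩ := hT.exists_insert_fst hX hV hTf (u n)
    obtain ⟨x, hx⟩ := hy.exists_insert_snd hX hV (hTf.insert _) (u n)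
    exact ⟨⟨_, hx, (hTf.insert _).insert _⟩, fun p hp => .inr (.inr hp), ⟨y, .inr (.inl rfl)⟩,
      ⟨x, .inl rfl⟩⟩
  choose N hsub hfst hsnd using step
  let T : ℕ → {T : Set (X × X) // IsIsometric T ∧ T.Finite} :=
    fun n => Nat.rec ⟨S, hS, hfin⟩ (fun n T => N T n) n
  have hmono : Monotone fun n => (T n).1 := monotone_nat_of_le_succ fun n => hsub (T n) n
  refine ⟨⋃ n, (T n).1, Set.subset_iUnion (fun n => (T n).1) 0, ?_, fun n => ?_, fun n => ?_⟩
  · intro p hp q hq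
    obtain ⟨n, hn⟩ := Set.mem_iUnion.1 hp
    obtain ⟨m, hm⟩ := Set.mem_iUnion.1 hq
    exact (T (max n m)).2.1 p (hmono (le_max_left n m) hn) q (hmono (le_max_right n m) hm)
  · obtain ⟨y, hy⟩ := hfst (T n) n
    exact ⟨y, Set.mem_iUnion.2 ⟨n + 1, hy⟩⟩
  · obtain ⟨x, hx⟩ := hsnd (T n) n
    exact ⟨x, Set.mem_iUnion.2 ⟨n + 1, hx⟩⟩

theorem eq_iff (hS : IsIsometric S) {p q : X × X} (hp : p ∈ S) (hq : q ∈ S) :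
    p.1 = q.1 ↔ p.2 = q.2 := by
  rw [← dist_eq_zero, hS p hp q hq, dist_eq_zero]

theorem exists_isometryEquiv (hS : IsIsometric S) (hfst : ∀ x, ∃ y, (x, y) ∈ S)
    (hsnd : ∀ y, ∃ x, (x, y) ∈ S) : ∃ φ : X ≃ᵢ X, ∀ p ∈ S, φ p.1 = p.2 := by
  choose f hf using hfst
  choose g hg using hsnd
  refine ⟨⟨⟨f, g, fun x => ?_, fun y => ?_⟩, Isometry.of_dist_eq fun x y => ?_⟩, fun p hp => ?_⟩
  · exact (hS.eq_iff (hg (f x)) (hf x)).2 rfl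
  · exact (hS.eq_iff (hf (g y)) (hg y)).1 rfl
  · exact (hS _ (hf x) _ (hf y)).symm
  · exact (hS.eq_iff (hf p.1) hp).1 rfl

theorem closure (hS : IsIsometric S) : IsIsometric (closure S) := by
  intro _ hp _ hq
  have hcl : IsClosed {z : (X × X) × (X × X) | dist z.1.1 z.2.1 = dist z.1.2 z.2.2} :=
    isClosed_eq (by fun_prop) (by fun_prop)
  have hmem := closure_prod_eq (s := S) (t := S) ▸ Set.mk_mem_prod hp hq
  exact hcl.closure_subset_iff.2 (fun z hz => hS _ hz.1 _ hz.2) hmem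

/-- Partners of a Cauchy sequence form a Cauchy sequence because `S` preserves distances; by
completeness they converge to a partner of the limit. -/
theorem exists_mem_closure_fst [CompleteSpace X] (hS : IsIsometric S) {u : ℕ → X}
    (hu : DenseRange u) (h : ∀ n, ∃ y, (u n, y) ∈ S) (x : X) :
    ∃ y, (x, y) ∈ _root_.closure S := by
  obtain ⟨z, hz, hzx⟩ := mem_closure_iff_seq_limit.1 (hu x)
  choose i hi using hz
  choose v hv using h
  have hvS : ∀ n, (z n, v (i n)) ∈ S := fun n => hi n ▸ hv (i n)
  have hc : CauchySeq fun n => v (i n) := by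
    have := hzx.cauchySeq
    rw [Metric.cauchySeq_iff] at this ⊢
    intro ε hε
    obtain ⟨N, hN⟩ := this ε hε
    exact ⟨N, fun m hm n hn => (hS _ (hvS m) _ (hvS n)) ▸ hN m hm n hn⟩
  obtain ⟨y, hy⟩ := cauchySeq_tendsto_of_complete hc
  exact ⟨y, mem_closure_of_tendsto (hzx.prodMk_nhds hy) (.of_forall hvS)⟩

theorem swap (hS : IsIsometric S) : IsIsometric (Prod.swap ⁻¹' S) :=
  fun _ hp _ hq => (hS _ hp _ hq).symm

theorem exists_mem_closure_snd [CompleteSpace X] (hS : IsIsometric S) {u : ℕ → X}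
    (hu : DenseRange u) (h : ∀ n, ∃ x, (x, u n) ∈ S) (y : X) :
    ∃ x, (x, y) ∈ _root_.closure S := by
  obtain ⟨x, hx⟩ := hS.swap.exists_mem_closure_fst hu h y
  refine ⟨x, ?_⟩
  have := (Homeomorph.prodComm X X).preimage_closure S
  exact (this.symm ▸ hx : (y, x) ∈ (Homeomorph.prodComm X X) ⁻¹' _root_.closure S)

end IsIsometric

theorem isIsometric_graph {X : Type} [MetricSpace X] {A : Set X} {f : A → X} (hf : Isometry f) :
    IsIsometric (Set.range fun a : A => ((a : X), f a)) := by
  rintro _ ⟨a, rfl⟩ _ ⟨b, rfl⟩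
  exact (hf.dist_eq a b).symm

theorem ExtensionProperty.isUltrahomogeneous_of_countable {V : Set ℝ} {X : Type} [MetricSpace X]
    [Countable X] (hX : ExtensionProperty V X) (hV : ∀ x y : X, dist x y ∈ V) :
    IsUltrahomogeneous X := by
  intro A f hA hf
  have : Finite A := hA
  have : Nonempty X := hX.nonempty
  obtain ⟨u, hu⟩ := exists_surjective_nat X
  obtain ⟨T, hST, hT, h1, h2⟩ := (isIsometric_graph hf).exists_back_and_forth hX hV
    (Set.finite_range _) u
  obtain ⟨φ, hφ⟩ := hT.exists_isometryEquiv (hu.forall.2 h1) (hu.forall.2 h2)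
  exact ⟨φ, fun a => hφ _ (hST ⟨a, rfl⟩)⟩

theorem ExtensionProperty.isUltrahomogeneous_of_complete {X : Type} [MetricSpace X]
    [CompleteSpace X] [TopologicalSpace.SeparableSpace X]
    (hX : ExtensionProperty Set.univ X) : IsUltrahomogeneous X := by
  intro A f hA hf
  have : Finite A := hA
  have : Nonempty X := hX.nonempty
  obtain ⟨u, hu⟩ := TopologicalSpace.exists_dense_seq X
  obtain ⟨T, hST, hT, h1, h2⟩ := (isIsometric_graph hf).exists_back_and_forth hX
    (fun _ _ => Set.mem_univ _) (Set.finite_range _) u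
  obtain ⟨φ, hφ⟩ := hT.closure.exists_isometryEquiv (hT.exists_mem_closure_fst hu h1)
    (hT.exists_mem_closure_snd hu h2)
  exact ⟨φ, fun a => hφ _ (subset_closure (hST ⟨a, rfl⟩))⟩

/-! ### From the rational to the real extension property -/

namespace ExtensionProperty

variable {X Y : Type} [MetricSpace X] [MetricSpace Y]

theorem exists_common_denom {ι : Type} [Finite ι] (r : ι → ℝ)
    (hr : ∀ i, r i ∈ Set.range ((↑) : ℚ → ℝ)) {ε : ℝ} (hε : 0 < ε) :
    ∃ Q : ℕ, 0 < Q ∧ 1 / (Q : ℝ) ≤ ε ∧ ∀ i, ∃ k : ℤ, (Q : ℝ) * r i = k := by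
  have : Fintype ι := Fintype.ofFinite ι
  choose q hq using hr
  obtain ⟨n, hn⟩ := exists_nat_one_div_lt hε
  have hpos : 0 < ∏ i, (q i).den := Finset.prod_pos fun i _ => (q i).den_pos
  refine ⟨(n + 1) * ∏ i, (q i).den, by positivity, hn.le.trans' ?_, fun i => ?_⟩
  · refine one_div_le_one_div_of_le (by positivity) ?_
    have : (n + 1) * 1 ≤ (n + 1) * ∏ i, (q i).den := Nat.mul_le_mul_left _ hpos
    rw [mul_one] at this
    exact_mod_cast this
  · obtain ⟨m, hm⟩ := Finset.dvd_prod_of_mem (fun i => (q i).den) (Finset.mem_univ i)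
    refine ⟨(n + 1) * m * (q i).num, ?_⟩
    have h : (q i : ℝ) * (q i).den = (q i).num := by exact_mod_cast Rat.mul_den_eq_num (q i)
    rw [hm, ← hq]
    push_cast [← h]
    ring

/-- A point of a dense rational subspace with prescribed approximate distances. -/
theorem exists_dist_approx (hY : ExtensionProperty (Set.range ((↑) : ℚ → ℝ)) Y)
    (hrat : ∀ x y : Y, dist x y ∈ Set.range ((↑) : ℚ → ℝ)) {j : Y → X} (hj : Isometry j)
    (hd : DenseRange j) {ι : Type} [Finite ι] [Nonempty ι] (p : ι → X) (r : ι → ℝ)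
    (hadd : ∀ i k, dist (p i) (p k) ≤ r i + r k) (hlip : ∀ i k, r i ≤ r k + dist (p i) (p k))
    {ε : ℝ} (hε : 0 < ε) : ∃ y : Y, ∀ i, |dist (j y) (p i) - r i| ≤ ε := by
  have hη : 0 < ε / 3 := by positivity
  have happ : ∀ i, ∃ y, dist (p i) (j y) < ε / 3 := fun i => hd.exists_dist_lt (p i) hη
  choose q hq using happ
  -- The Katětov extension of `r`, the minimum over `k` of `r k + dist · (p k)`, is evaluated at the
  -- nearby points `q i`. It stays admissible and changes values by at most `ε / 3`.
  have hmin : ∀ i, ∃ k, ∀ k', r k + dist (j (q i)) (p k) ≤ r k' + dist (j (q i)) (p k') :=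
    fun i => Finite.exists_min fun k => r k + dist (j (q i)) (p k)
  choose m hm using hmin
  let ρ : ι → ℝ := fun i => r (m i) + dist (j (q i)) (p (m i))
  have hρlip : ∀ i k, ρ i ≤ ρ k + dist (q i) (q k) := by
    intro i k
    have h1 := hm i (m k)
    have h2 := dist_triangle (j (q i)) (j (q k)) (p (m k))
    rw [hj.dist_eq] at h2
    simp only [ρ]
    linarith
  have hρadd : ∀ i k, dist (q i) (q k) ≤ ρ i + ρ k := by
    intro i k
    have h1 := hadd (m i) (m k)
    have h2 := dist_triangle4 (j (q i)) (p (m i)) (p (m k)) (j (q k))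
    rw [hj.dist_eq, dist_comm (p (m k))] at h2
    simp only [ρ]
    linarith
  have hρle : ∀ i, ρ i ≤ r i + ε / 3 := by
    intro i
    have h1 := hm i i
    have h2 := hq i
    rw [dist_comm] at h2
    simp only [ρ]
    linarith
  have hleρ : ∀ i, r i - ε / 3 ≤ ρ i := by
    intro i
    have h1 := hlip i (m i)
    have h2 := dist_triangle (p i) (j (q i)) (p (m i))
    have h3 := hq i
    simp only [ρ]
    linarith
  obtain ⟨Q, hQ, hQε, hQd⟩ := exists_common_denom (fun ik : ι × ι => dist (q ik.1) (q ik.2))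
    (fun ik => hrat _ _) hη
  have hQ' : (0 : ℝ) < Q := by exact_mod_cast hQ
  -- Rounding up to multiples of `1 / Q` preserves the sum inequalities. It also preserves the
  -- Lipschitz inequalities exactly, since the distances of the `q i` are themselves multiples of `1
  -- / Q`.
  let R : ι → ℝ := fun i => (⌈(Q : ℝ) * ρ i⌉ : ℝ) / Q
  have hRle : ∀ i, R i ≤ ρ i + 1 / Q := by
    intro i
    have := (Int.ceil_lt_add_one ((Q : ℝ) * ρ i)).le
    simp only [R]
    rw [div_le_iff₀ hQ', add_mul, one_div_mul_cancel hQ'.ne']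
    linarith
  have hleR : ∀ i, ρ i ≤ R i := by
    intro i
    have := Int.le_ceil ((Q : ℝ) * ρ i)
    simp only [R]
    rw [le_div_iff₀ hQ']
    linarith
  obtain ⟨y, hy⟩ := hY ι q R
    (fun i => ⟨(⌈(Q : ℝ) * ρ i⌉ : ℚ) / Q, by simp [R]⟩)
    (fun i k => (hρadd i k).trans (add_le_add (hleR i) (hleR k)))
    (fun i k => by
      obtain ⟨d, hd⟩ := hQd (i, k)
      have h1 : (Q : ℝ) * ρ i ≤ Q * ρ k + d := by
        rw [← hd, ← mul_add]
        exact mul_le_mul_of_nonneg_left (hρlip i k) hQ'.le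
      have h2 : ⌈(Q : ℝ) * ρ i⌉ ≤ ⌈(Q : ℝ) * ρ k⌉ + d := by
        rw [← Int.ceil_add_intCast]
        exact Int.ceil_mono h1
      have h3 : (⌈(Q : ℝ) * ρ i⌉ : ℝ) ≤ ⌈(Q : ℝ) * ρ k⌉ + d := by exact_mod_cast h2
      simp only [R]
      rw [div_le_iff₀ hQ', add_mul, div_mul_cancel₀ _ hQ'.ne', mul_comm (dist _ _)]
      exact h3.trans_eq (by rw [hd]))
  refine ⟨y, fun i => ?_⟩
  have h1 := abs_le.1 (abs_dist_sub_le (p i) (j (q i)) (j y))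
  have h2 : dist (j (q i)) (j y) = R i := by rw [hj.dist_eq, dist_comm, hy]
  rw [h2] at h1
  rw [dist_comm, abs_le]
  have h3 := hq i
  have h4 := hRle i
  have h5 := hleR i
  have h6 := hρle i
  have h7 := hleρ i
  constructor <;> linarith [h1.1, h1.2]

/-- Approximations can be improved without moving far. -/
theorem exists_dist_approx_near (hY : ExtensionProperty (Set.range ((↑) : ℚ → ℝ)) Y)
    (hrat : ∀ x y : Y, dist x y ∈ Set.range ((↑) : ℚ → ℝ)) {j : Y → X} (hj : Isometry j)
    (hd : DenseRange j) {ι : Type} [Finite ι] [Nonempty ι] (p : ι → X) (r : ι → ℝ)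
    (hadd : ∀ i k, dist (p i) (p k) ≤ r i + r k) (hlip : ∀ i k, r i ≤ r k + dist (p i) (p k))
    {δ : ℝ} (hδ : 0 < δ) (y : Y) (hy : ∀ i, |dist (j y) (p i) - r i| ≤ δ) :
    ∃ y' : Y, (∀ i, |dist (j y') (p i) - r i| ≤ δ / 2) ∧ dist (j y) (j y') ≤ 2 * δ := by
  obtain ⟨m, hm⟩ := Finite.exists_max fun i => |dist (j y) (p i) - r i|
  -- The largest error `M` is an admissible distance to prescribe from `y` itself. Adding `y` to the
  -- family with this value keeps the improved point close to `y`.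
  set M := |dist (j y) (p m) - r m| with hM
  have hM0 : 0 ≤ M := abs_nonneg _
  have hle : ∀ i, dist (j y) (p i) - r i ≤ M ∧ r i - dist (j y) (p i) ≤ M := fun i =>
    ⟨(le_abs_self _).trans (hm i), by
      rw [← neg_sub (dist (j y) (p i))]
      exact (neg_le_abs _).trans (hm i)⟩
  have hMle : ∀ i, M ≤ r i + dist (j y) (p i) := by
    intro i
    have h1 := hadd m i
    have h2 := hlip m i
    have h3 := dist_triangle_right (j y) (p m) (p i)
    have h4 := dist_triangle_left (p m) (p i) (j y)
    rw [hM, abs_le']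
    constructor <;> linarith
  obtain ⟨y', hy'⟩ := exists_dist_approx hY hrat hj hd (ι := Option ι)
    (fun o => o.elim (j y) p) (fun o => o.elim M r)
    (by
      rintro (_ | i) (_ | k)
      · simp [hM0]
      · have := (hle k).1
        simp only [Option.elim]
        linarith
      · have := (hle i).1
        simp only [Option.elim]
        rw [dist_comm]
        linarith
      · exact hadd i k)
    (by
      rintro (_ | i) (_ | k)
      · simp
      · exact hMle k
      · have := (hle i).2
        simp only [Option.elim]
        rw [dist_comm]
        linarith
      · exact hlip i k)
    (half_pos hδ)
  refine ⟨y', fun i => hy' (some i), ?_⟩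
  have h1 := (abs_le.1 (hy' none)).2
  have h2 : M ≤ δ := hy m
  simp only [Option.elim] at h1
  rw [dist_comm]
  linarith

/-- Halving the error at every step moves the approximating point by a geometrically decreasing
amount, so the points converge to an exact solution. -/
theorem of_dense_rational [CompleteSpace X]
    (hY : ExtensionProperty (Set.range ((↑) : ℚ → ℝ)) Y)
    (hrat : ∀ x y : Y, dist x y ∈ Set.range ((↑) : ℚ → ℝ)) {j : Y → X} (hj : Isometry j)
    (hd : DenseRange j) : ExtensionProperty Set.univ X := by
  intro ι _ p r _ hadd hlip
  rcases isEmpty_or_nonempty ι with hι | hι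
  · exact ⟨j hY.nonempty.some, fun i => hι.elim i⟩
  have hpow : ∀ n : ℕ, (0 : ℝ) < (1 / 2) ^ n := fun n => by positivity
  let P : ℕ → Type := fun n => {y : Y // ∀ i, |dist (j y) (p i) - r i| ≤ (1 / 2 : ℝ) ^ n}
  have start : Nonempty (P 0) := by
    obtain ⟨y, hy⟩ := exists_dist_approx hY hrat hj hd p r hadd hlip (hpow 0)
    exact ⟨⟨y, hy⟩⟩
  have step : ∀ n (y : P n), ∃ y' : P (n + 1),
      dist (j y.1) (j y'.1) ≤ 2 * (1 / 2 : ℝ) ^ n := by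
    rintro n ⟨y, hy⟩
    obtain ⟨y', h1, h2⟩ := exists_dist_approx_near hY hrat hj hd p r hadd hlip (hpow n) y hy
    exact ⟨⟨y', fun i => (h1 i).trans_eq (by rw [pow_succ]; ring)⟩, h2⟩
  choose S hS using step
  let y : ∀ n, P n := fun n => Nat.rec start.some (fun n y => S n y) n
  have hc : CauchySeq fun n => j (y n).1 :=
    cauchySeq_of_le_geometric (1 / 2) 2 (by norm_num) fun n => hS n (y n)
  obtain ⟨z, hz⟩ := cauchySeq_tendsto_of_complete hc
  refine ⟨z, fun i => ?_⟩
  have h1 : Filter.Tendsto (fun n => |dist (j (y n).1) (p i) - r i|) Filter.atTop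
      (nhds |dist z (p i) - r i|) := ((hz.dist tendsto_const_nhds).sub_const _).abs
  have h2 : Filter.Tendsto (fun n : ℕ => (1 / 2 : ℝ) ^ n) Filter.atTop (nhds 0) :=
    tendsto_pow_atTop_nhds_zero_of_lt_one (by norm_num) (by norm_num)
  have h3 := le_of_tendsto_of_tendsto' h1 h2 fun n => (y n).2 i
  exact sub_eq_zero.1 (abs_nonpos_iff.1 h3)

end ExtensionProperty

/-! ### The metric of the generic norm -/

/-- The two-sided invariant metric of a rational invariant norm. -/
@[reducible] def IsInvNorm.metricSpace {G : Type*} [Group G] {l : G → ℚ} (hl : IsInvNorm l) :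
    MetricSpace G where
  dist x y := (l (x * y⁻¹) : ℝ)
  dist_self x := by simp [hl.map_one]
  dist_comm x y := by
    rw [← hl.map_inv]
    simp
  dist_triangle x y z := by
    have := hl.map_mul (x * y⁻¹) (y * z⁻¹)
    rw [show x * y⁻¹ * (y * z⁻¹) = x * z⁻¹ by group] at this
    exact_mod_cast this
  eq_of_dist_eq_zero {x y} h := mul_inv_eq_one.1 (hl.eq_one _ (by exact_mod_cast h))

theorem IsInvNorm.isTwoSidedInvariant {G : Type*} [Group G] {l : G → ℚ} (hl : IsInvNorm l) :
    letI := hl.metricSpace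
    IsTwoSidedInvariant G :=
  letI := hl.metricSpace
  { left := fun g x y => by
      change ((l (g * x * (g * y)⁻¹) : ℚ) : ℝ) = (l (x * y⁻¹) : ℚ)
      rw [show g * x * (g * y)⁻¹ = g * (x * y⁻¹) * g⁻¹ by group, hl.map_conj]
    right := fun g x y => by
      change ((l (x * g * (y * g)⁻¹) : ℚ) : ℝ) = (l (x * y⁻¹) : ℚ)
      rw [show x * g * (y * g)⁻¹ = x * y⁻¹ by group] }

theorem IsInvNorm.extensionProperty {l : FreeGroup ℕ → ℚ} (hl : IsInvNorm l)
    (hgen : ∀ p : FreeGroup ℕ →₀ ℚ, IsAdmissible l p → ∃ z, ∀ a ∈ p.support, l (z * a⁻¹) = p a) :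
    letI := hl.metricSpace
    ExtensionProperty (Set.range ((↑) : ℚ → ℝ)) (FreeGroup ℕ) := by
  classical
  let _ := hl.metricSpace
  have hdist : ∀ x y : FreeGroup ℕ, dist x y = (l (x * y⁻¹) : ℝ) := fun _ _ => rfl
  intro ι _ p r hr hadd hlip
  have : Fintype ι := Fintype.ofFinite ι
  rcases isEmpty_or_nonempty ι with hι | hι
  · exact ⟨1, fun i => hι.elim i⟩
  -- A zero value is invisible in the support of a finitely supported function, but then the point
  -- `p i` itself is a solution.
  by_cases h0 : ∃ i, r i = 0
  · obtain ⟨i, hi⟩ := h0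
    refine ⟨p i, fun k => ?_⟩
    have h1 := hadd i k
    have h2 := hlip k i
    rw [dist_comm (p k)] at h2
    linarith
  push Not at h0
  have hr0 : ∀ i, 0 ≤ r i := fun i => by
    have := hadd i i
    rw [dist_self] at this
    linarith
  choose q hq using hr
  -- The family may repeat points; the Lipschitz condition makes the values depend on the point
  -- alone.
  have hwd : ∀ i k, p i = p k → q i = q k := by
    intro i k hik
    have h1 := hlip i k
    have h2 := hlip k i
    rw [hik, dist_self, ← hq, ← hq] at h1 h2
    have : (q i : ℝ) = q k := by linarith
    exact_mod_cast this
  let F : FreeGroup ℕ → ℚ := fun a => if h : ∃ i, p i = a then q h.choose else 0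
  have hF : ∀ i, F (p i) = q i := by
    intro i
    have h : ∃ k, p k = p i := ⟨i, rfl⟩
    simp only [F, dif_pos h]
    exact hwd _ _ h.choose_spec
  let P : FreeGroup ℕ →₀ ℚ := Finsupp.onFinset (Finset.univ.image p) F fun a ha => by
    by_contra hne
    refine ha (dif_neg ?_)
    rintro ⟨i, rfl⟩
    exact hne (Finset.mem_image_of_mem p (Finset.mem_univ i))
  have hP : ∀ i, P (p i) = q i := hF
  have hmem : ∀ a ∈ P.support, ∃ i, p i = a := by
    intro a ha
    obtain ⟨i, -, hi⟩ := Finset.mem_image.1 (Finsupp.support_onFinset_subset ha)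
    exact ⟨i, hi⟩
  have hsupp : ∀ i, p i ∈ P.support := by
    intro i
    rw [Finsupp.mem_support_iff, hP]
    intro h
    exact h0 i (by rw [← hq, h, Rat.cast_zero])
  obtain ⟨z, hz⟩ := hgen P
    { nonempty := ⟨p hι.some, hsupp _⟩
      nonneg := fun a ha => by
        obtain ⟨i, rfl⟩ := hmem a ha
        have := hr0 i
        rw [← hq] at this
        rw [hP]
        exact_mod_cast this
      le_add := fun a ha b hb => by
        obtain ⟨i, rfl⟩ := hmem a ha
        obtain ⟨k, rfl⟩ := hmem b hb
        have := hadd i k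
        rw [← hq, ← hq, hdist] at this
        rw [hP, hP]
        exact_mod_cast this
      lipschitz := fun a ha b hb => by
        obtain ⟨i, rfl⟩ := hmem a ha
        obtain ⟨k, rfl⟩ := hmem b hb
        have := hlip i k
        rw [← hq, ← hq, hdist] at this
        rw [hP, hP]
        exact_mod_cast this }
  refine ⟨z, fun i => ?_⟩
  rw [hdist, hz _ (hsupp i), hP, hq]

/-! ### The group structure on the completion -/

namespace IsTwoSidedInvariant

open UniformSpace

variable {G : Type*} [Group G] [MetricSpace G]

/-- Two-sided invariance gives `dist (a / b) (c / d) ≤ dist a c + dist b d`, so division is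
uniformly continuous. -/
theorem isUniformGroup (h : IsTwoSidedInvariant G) : IsUniformGroup G := by
  refine ⟨Metric.uniformContinuous_iff.2 fun ε hε => ⟨ε / 2, half_pos hε, ?_⟩⟩
  rintro ⟨a, b⟩ ⟨c, d⟩ hd
  rw [Prod.dist_eq, max_lt_iff] at hd
  have h1 : dist (a / b) (c / b) = dist a c := by simp only [div_eq_mul_inv, h.right]
  have h2 : dist (c / b) (c / d) = dist b d := by
    rw [div_eq_mul_inv, div_eq_mul_inv, h.left, ← h.left b, ← h.right d, dist_comm]
    simp
  have := dist_triangle (a / b) (c / b) (c / d)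
  change dist (a / b) (c / d) < ε
  linarith [hd.1, hd.2]

/-- The group structure on the completion of a group with a two-sided invariant metric. -/
@[reducible] noncomputable def completionGroup (h : IsTwoSidedInvariant G) :
    Group (Completion G) :=
  have := h.isUniformGroup
  have hmul : Continuous fun p : Completion G × Completion G =>
      Completion.map₂ (· * · : G → G → G) p.1 p.2 :=
    Completion.continuous_map₂ continuous_fst continuous_snd
  have hinv : Continuous (Completion.map (·⁻¹ : G → G)) := Completion.continuous_map
  have cmul : ∀ a b : G, Completion.map₂ (· * · : G → G → G) (a : Completion G) b =
      ((a * b : G) : Completion G) :=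
    fun a b => Completion.map₂_coe_coe a b _ uniformContinuous_mul
  have cinv : ∀ a : G, Completion.map (·⁻¹ : G → G) (a : Completion G) =
      ((a⁻¹ : G) : Completion G) :=
    Completion.map_coe uniformContinuous_inv
  { mul := Completion.map₂ (· * ·)
    one := ((1 : G) : Completion G)
    inv := Completion.map (·⁻¹)
    -- Each group law is a closed condition that holds on the dense copy of `G`.
    mul_assoc := fun a b c => by
      refine Completion.induction_on₃ a b c
        (isClosed_eq
          (hmul.comp ((hmul.comp (continuous_fst.prodMk (continuous_fst.comp continuous_snd))).prodMk
            (continuous_snd.comp continuous_snd)))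
          (hmul.comp (continuous_fst.prodMk (hmul.comp continuous_snd)))) fun a b c => ?_
      change Completion.map₂ (· * · : G → G → G) (Completion.map₂ (· * · : G → G → G) a b) c =
        Completion.map₂ (· * · : G → G → G) a (Completion.map₂ (· * · : G → G → G) b c)
      rw [cmul, cmul, cmul, cmul, mul_assoc]
    one_mul := fun a => by
      refine Completion.induction_on a
        (isClosed_eq (hmul.comp (continuous_const.prodMk continuous_id)) continuous_id) fun a => ?_
      exact (cmul 1 a).trans (by rw [one_mul])
    mul_one := fun a => by
      refine Completion.induction_on a
        (isClosed_eq (hmul.comp (continuous_id.prodMk continuous_const)) continuous_id) fun a => ?_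
      exact (cmul a 1).trans (by rw [mul_one])
    inv_mul_cancel := fun a => by
      refine Completion.induction_on a
        (isClosed_eq (hmul.comp (hinv.prodMk continuous_id)) continuous_const) fun a => ?_
      change Completion.map₂ (· * · : G → G → G) (Completion.map (·⁻¹ : G → G) a) a =
        ((1 : G) : Completion G)
      rw [cinv, cmul, inv_mul_cancel] }

theorem coe_mul (h : IsTwoSidedInvariant G) (x y : G) :
    letI := h.completionGroup
    ((x * y : G) : Completion G) = (x : Completion G) * (y : Completion G) :=
  have := h.isUniformGroup
  (Completion.map₂_coe_coe x y (· * ·) uniformContinuous_mul).symm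

theorem isTopologicalGroup_completion (h : IsTwoSidedInvariant G) :
    letI := h.completionGroup
    IsTopologicalGroup (Completion G) :=
  letI := h.completionGroup
  { continuous_mul := Completion.continuous_map₂ continuous_fst continuous_snd
    continuous_inv := Completion.continuous_map }

theorem completion (h : IsTwoSidedInvariant G) :
    letI := h.completionGroup
    IsTwoSidedInvariant (Completion G) := by
  let _ := h.completionGroup
  have := h.isTopologicalGroup_completion
  refine ⟨fun g x y => ?_, fun g x y => ?_⟩
  · refine Completion.induction_on₃ g x y (isClosed_eq (by fun_prop) (by fun_prop)) fun g x y => ?_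
    rw [← h.coe_mul, ← h.coe_mul, Completion.dist_eq, Completion.dist_eq, h.left]
  · refine Completion.induction_on₃ g x y (isClosed_eq (by fun_prop) (by fun_prop)) fun g x y => ?_
    rw [← h.coe_mul, ← h.coe_mul, Completion.dist_eq, Completion.dist_eq, h.right]

end IsTwoSidedInvariant

/-! ### Assembly of the theorem -/

theorem theorem1 :
    ∃ _ : MetricSpace (FreeGroup ℕ),
      IsTwoSidedInvariant (FreeGroup ℕ) ∧
      IsRationalUrysohn (FreeGroup ℕ) ∧
      ∃ _ : Group (UniformSpace.Completion (FreeGroup ℕ)),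
        (∀ x y : FreeGroup ℕ,
          ((x * y : FreeGroup ℕ) : UniformSpace.Completion (FreeGroup ℕ)) =
            (x : UniformSpace.Completion (FreeGroup ℕ)) * (y : UniformSpace.Completion (FreeGroup ℕ))) ∧
        IsTopologicalGroup (UniformSpace.Completion (FreeGroup ℕ)) ∧
        PolishSpace (UniformSpace.Completion (FreeGroup ℕ)) ∧
        IsTwoSidedInvariant (UniformSpace.Completion (FreeGroup ℕ)) ∧
        (∃ x y : UniformSpace.Completion (FreeGroup ℕ), x * y ≠ y * x) ∧
        IsUrysohn (UniformSpace.Completion (FreeGroup ℕ)) := by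
  obtain ⟨l, hl, hgen⟩ := exists_generic_norm
  let _ := hl.metricSpace
  have hinv : IsTwoSidedInvariant (FreeGroup ℕ) := hl.isTwoSidedInvariant
  have hrat : ∀ x y : FreeGroup ℕ, dist x y ∈ Set.range ((↑) : ℚ → ℝ) :=
    fun x y => ⟨l (x * y⁻¹), rfl⟩
  have hext : ExtensionProperty (Set.range ((↑) : ℚ → ℝ)) (FreeGroup ℕ) :=
    hl.extensionProperty hgen
  have hcount : Countable (FreeGroup ℕ) := FreeGroup.toWord_injective.countable
  have hext' : ExtensionProperty Set.univ (UniformSpace.Completion (FreeGroup ℕ)) :=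
    hext.of_dense_rational hrat UniformSpace.Completion.coe_isometry
      UniformSpace.Completion.denseRange_coe
  have hsep : TopologicalSpace.SeparableSpace (UniformSpace.Completion (FreeGroup ℕ)) :=
    inferInstance
  have hsc : SecondCountableTopology (UniformSpace.Completion (FreeGroup ℕ)) :=
    UniformSpace.secondCountable_of_separable _
  refine ⟨hl.metricSpace, hinv, ⟨hcount, fun x y => ⟨_, rfl⟩, fun F _ _ hF => ?_, ?_⟩,
    hinv.completionGroup, hinv.coe_mul, hinv.isTopologicalGroup_completion, inferInstance,
    hinv.completion, ?_, ⟨inferInstance, hsep, fun F _ _ => ?_, ?_⟩⟩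
  · exact hext.exists_isometry F fun x y => (hF x y).imp fun q hq => hq.symm
  · exact hext.isUltrahomogeneous_of_countable hrat
  · refine ⟨(FreeGroup.of 0 : FreeGroup ℕ), (FreeGroup.of 1 : FreeGroup ℕ), fun h => ?_⟩
    rw [← hinv.coe_mul, ← hinv.coe_mul] at h
    exact absurd (UniformSpace.Completion.coe_injective _ h) (by decide)
  · exact hext'.exists_isometry F fun _ _ => Set.mem_univ _
  · exact hext'.isUltrahomogeneous_of_complete
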